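/- Let $S$ and $A$ be finite sets, $s_0\in S$, $E\subseteq S\times A\times S$, let $\lambda:S\times A\times S\to 2^{\mathcal{AP}}$ be a label function, and let $\mathcal A=(Q,2^{\mathcal{AP}},q_0,\delta,F)$ be a deterministic Rabin automaton with finite state set $Q$ and Rabin pairs $(A_i,R_i)\in F$. A transition function $P:S\times A\times S\to[0,1]$ (with $\sum_{s'}P(s,a,s')=1$ for all $s,a$) has support $E$ if $E=\{(s,a,s')\mid P(s,a,s')>0\}$. A policy $\pi$ maps finite runs in $S\times(A\times S)^*$ to probability distributions on $A$; with the MDP $\mathcal M=(S,A,s_0,P)$ it induces a probability measure $\mathcal D_\pi^{\mathcal M}$ on infinite runs $\rho=s_0a_0s_1a_1\ldots$. Let $J^{\mathcal M}_{\mathcal A}(\pi)$ be the probability that $\mathcal A$ accepts $\lambda(s_0,a_0,s_1)\lambda(s_1,a_1,s_2)\ldots$ *Product and ASECs.* The product MDP has states $V=S\times Q$, transition function $\Delta((s,q),a,(s',q'))=P(s,a,s')$ if $\delta(q,\lambda(s,a,s'))=q'$ and $0$ otherwise, and accepting pairs $(S\times A_i,S\times R_i)$. A pair $(T,\mathrm{Act})$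 with $T\subseteq V$, $\mathrm{Act}:T\to2^A$ is an end component if $\sum_{v'\in T}\Delta(v,a,v')=1$ for all $v\in T$, $a\in\mathrm{Act}(v)$, and the graph on $T$ with an edge $v\to v'$ iff $\Delta(v,a,v')>0$ for some $a\in\mathrm{Act}(v)$ is strongly connected. It is an accepting simple end component (ASEC) if moreover, for some $i$, $T\cap(S\times A_i)\neq\emptyset$ and $T\cap(S\times R_i)=\emptyset$, and $|\mathrm{Act}(v)|=1$ for all $v\in T$. A covering family is a finite sequence $\mathcal C_1=(T_1,\mathrm{Act}_1),\dots,\mathcal C_n=(T_n,\mathrm{Act}_n)$ of ASECs such that every state lying in some ASEC lies in $T_1\cup\dots\cup T_n$. *Reward machine.* For $v\in T_1\cup\dots\cup T_n$ let $\mathrm{Act}_v=\mathrm{Act}_i$ with $i$ minimal such that $v\in T_i$. The reward machine $\mathcal R$ of the family has states $Q\cup\{\bot\}$, initial state $q_0$, update $$\delta_u(u,(s,a,s'))=\begin{cases}\bot&\text{if }u=\bot\text{, or }(s,u)\in T_1\cup\dots\cup T_n\text{ and }a\notin\mathrm{Act}_{(s,u)}(s,u),\\ \delta(u,\lambda(s,a,s'))&\text{otherwise,}\end{cases}$$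 and reward $\delta_r(u,(s,a,s'))=1$ if $u\ne\bot$ and $(s,u)\in T_1\cup\dots\cup T_n$, and $0$ otherwise. With $u_0=q_0$, $u_{i+1}=\delta_u(u_i,(s_i,a_i,s_{i+1}))$, let $$J^{\mathcal M}_{\mathcal R}(\pi)=\liminf_{t\to\infty}\mathbb E_{\rho\sim\mathcal D_\pi^{\mathcal M}}\Big[\tfrac1t\sum_{i=0}^{t-1}\delta_r(u_i,(s_i,a_i,s_{i+1}))\Big].$$ **Theorem.** (a) There are $n\le|S\times Q|$ and a sequence $\mathcal C_1,\dots,\mathcal C_n$ that is a covering family for every transition function with support $E$. (b) Let $\mathcal C_1,\dots,\mathcal C_n$ ($n$ arbitrary) be a covering family for some transition function with support $E$, and let $\mathcal R$ be its reward machine. Then for every transition function $P$ with support $E$ and $\mathcal M=(S,A,s_0,P)$: 1. every policy maximising $J^{\mathcal M}_{\mathcal R}$ over all policies also maximises $J^{\mathcal M}_{\mathcal A}$; 2. $J^{\mathcal M}_{\mathcal R}(\pi)\le J^{\mathcal M}_{\mathcal A}(\pi)$ for every policy $\pi$; 3. for every policy $\pi$ there is a policy $\pi'$ with $J^{\mathcal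 M}_{\mathcal A}(\pi)\le J^{\mathcal M}_{\mathcal R}(\pi')$. -/

import Mathlib

open MeasureTheory ProbabilityTheory

noncomputable section

namespace RLSpec

/-! ### Markov decision processes, runs and policies -/

/-- A probability transition function: `P s a s'` is the probability of moving from `s` to `s'`
under the action `a`. -/
abbrev TransFun (S A : Type*) := S → A → PMF S

/-- The support `{(s, a, s') | P(s, a, s') > 0}` of a transition function. -/
def TransFun.supp {S A : Type*} (P : TransFun S A) : Set (S × A × S) :=
  {e | 0 < P e.1 e.2.1 e.2.2}

/-- A Markov decision process with state set `S` and action set `A`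
(both assumed finite where it matters). -/
structure MDP (S A : Type*) where
  /-- the initial state -/
  init : S
  /-- the transition function -/
  trans : TransFun S A

/-- Finite runs `S × (A × S)^*`. -/
abbrev FinRun (S A : Type*) := S × List (A × S)

/-- Infinite runs `(S × A)^ω`; `ρ i = (s_i, a_i)`. -/
abbrev Run (S A : Type*) := ℕ → S × A

/-- Policies map finite runs to distributions over actions. -/
abbrev Policy (S A : Type*) := FinRun S A → PMF A

/-- The `i`-th transition `(s_i, a_i, s_{i+1})` of an infinite run. -/
def Run.trans {S A : Type*} (ρ : Run S A) (i : ℕ) : S × A × S :=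
  ((ρ i).1, (ρ i).2, (ρ (i + 1)).1)

section Measure

variable {S A : Type*} [Fintype S] [MeasurableSpace S] [MeasurableSingletonClass S]
  [Fintype A] [MeasurableSpace A] [MeasurableSingletonClass A]

/-- The finite run `s_0 a_0 s_1 … a_{n-1} s_n` in the first `n + 1` state-action pairs
`(s_0, a_0), …, (s_n, a_n)`. -/
def finRunOfHist {S A : Type*} (n : ℕ) (h : (i : Finset.Iic n) → S × A) : FinRun S A :=
  ((h ⟨0, Finset.mem_Iic.2 (Nat.zero_le n)⟩).1,
    List.ofFn fun i : Fin n =>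
      ((h ⟨i, Finset.mem_Iic.2 i.2.le⟩).2, (h ⟨i + 1, Finset.mem_Iic.2 i.2⟩).1))

/-- The law of `(s_{n+1}, a_{n+1})` given `(s_0, a_0), …, (s_n, a_n)`: draw `s_{n+1}` from
`P(s_n, a_n, ·)`, then `a_{n+1}` from `π(s_0 a_0 … s_n a_n s_{n+1})`. -/
def stepPMF {S A : Type*} (M : MDP S A) (π : Policy S A) (n : ℕ)
    (h : (i : Finset.Iic n) → S × A) : PMF (S × A) :=
  let x := h ⟨n, Finset.mem_Iic.2 le_rfl⟩
  let r := finRunOfHist n h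
  (M.trans x.1 x.2).bind fun s' => (π (r.1, r.2 ++ [(x.2, s')])).map fun a' => (s', a')

/-- The one-step kernels of the process of state-action pairs. -/
def stepKernel (M : MDP S A) (π : Policy S A) (n : ℕ) :
    Kernel ((i : Finset.Iic n) → S × A) (S × A) :=
  Kernel.ofFunOfCountable fun h => (stepPMF M π n h).toMeasure

instance (M : MDP S A) (π : Policy S A) (n : ℕ) : IsMarkovKernel (stepKernel M π n) :=
  ⟨fun h => PMF.toMeasure.isProbabilityMeasure (stepPMF M π n h)⟩

/-- The law of `(s_0, a_0)`, with `s_0` the initial state and `a_0` drawn from `π(s_0)`. -/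
def initPMF {S A : Type*} (M : MDP S A) (π : Policy S A) : PMF (S × A) :=
  (π (M.init, [])).map fun a => (M.init, a)

/-- The probability measure on infinite runs induced by an MDP and a policy
(Ionescu-Tulcea construction). -/
def runMeasure (M : MDP S A) (π : Policy S A) : Measure (Run S A) :=
  Kernel.trajMeasure (X := fun _ => S × A) (initPMF M π).toMeasure (stepKernel M π)

end Measure

/-! ### Deterministic Rabin automata -/

/-- A deterministic Rabin automaton with state set `Q` over the alphabet `2^AP`. As `Q` is finite
where it matters, so is the set of Rabin pairs. -/
structure DRA (Q AP : Type*) where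
  init : Q
  next : Q → Set AP → Q
  /-- the Rabin pairs `(A_i, R_i)` -/
  acc : Set (Set Q × Set Q)

/-- The sequence of states visited by a DRA on an infinite word. -/
def DRA.stateSeq {Q AP : Type*} (D : DRA Q AP) (w : ℕ → Set AP) : ℕ → Q
  | 0 => D.init
  | i + 1 => D.next (D.stateSeq w i) (w i)

/-- The set of elements occurring infinitely often in a sequence. -/
def infOften {X : Type*} (x : ℕ → X) : Set X :=
  {y | ∃ᶠ i in Filter.atTop, x i = y}

/-- Rabin acceptance of an infinite word. -/
def DRA.Accepts {Q AP : Type*} (D : DRA Q AP) (w : ℕ → Set AP) : Prop :=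
  ∃ p ∈ D.acc, infOften (D.stateSeq w) ∩ p.1 ≠ ∅ ∧ infOften (D.stateSeq w) ∩ p.2 = ∅

/-- The probability that the label sequence of a run is accepted by the automaton. -/
def accProb {S A Q AP : Type*} [Fintype S] [MeasurableSpace S] [MeasurableSingletonClass S]
    [Fintype A] [MeasurableSpace A] [MeasurableSingletonClass A]
    (M : MDP S A) (L : S × A × S → Set AP) (D : DRA Q AP) (π : Policy S A) : ℝ :=
  (runMeasure M π).real {ρ | D.Accepts fun i => L (ρ.trans i)}

/-! ### Reward machines and limit-average reward -/

/-- A reward machine with state set `U`. -/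
structure RewardMachine (S A U : Type*) where
  init : U
  /-- the update function `δ_u` -/
  upd : U → S × A × S → U
  /-- the reward function `δ_r` -/
  rew : U → S × A × S → ℝ

/-- The sequence of machine states induced by an infinite run. -/
def RewardMachine.stateSeq {S A U : Type*} (R : RewardMachine S A U) (ρ : Run S A) : ℕ → U
  | 0 => R.init
  | i + 1 => R.upd (R.stateSeq ρ i) (ρ.trans i)

/-- The limit-average reward of a policy. -/
def limAvg {S A U : Type*} [Fintype S] [MeasurableSpace S] [MeasurableSingletonClass S]
    [Fintype A] [MeasurableSpace A] [MeasurableSingletonClass A]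
    (M : MDP S A) (R : RewardMachine S A U) (π : Policy S A) : ℝ :=
  Filter.liminf
    (fun t : ℕ => ∫ ρ, (1 / (t : ℝ)) * ∑ i ∈ Finset.range t, R.rew (R.stateSeq ρ i) (ρ.trans i)
      ∂(runMeasure M π))
    Filter.atTop

/-- A policy maximises an objective `J` if no policy has a larger value. -/
def Maximises {S A : Type*} (J : Policy S A → ℝ) (π : Policy S A) : Prop :=
  ∀ π', J π' ≤ J π

/-! ### The product with a DRA and its end components -/

open Classical in
/-- The transition function `Δ` of the product MDP. -/
def prodTrans {S A Q AP : Type*} (P : TransFun S A) (L : S × A × S → Set AP) (D : DRA Q AP)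
    (v : S × Q) (a : A) (v' : S × Q) : ENNReal :=
  if D.next v.2 (L (v.1, a, v'.1)) = v'.2 then P v.1 a v'.1 else 0

/-- The accepting condition of the product MDP: the pairs `(S × A_i, S × R_i)`. -/
def prodAcc {Q AP : Type*} (S : Type*) (D : DRA Q AP) : Set (Set (S × Q) × Set (S × Q)) :=
  (fun p => (Set.univ ×ˢ p.1, Set.univ ×ˢ p.2)) '' D.acc

/-- A pair `(T, Act)` with `T ⊆ V` and `Act : T → 2^A`
(the values of `act` outside `T` are irrelevant). -/
structure SubMDP (V A : Type*) where
  T : Finset V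
  act : V → Finset A

/-- The edges `v →_Act v'` of the graph on `T`. -/
def SubMDP.Edge {V A : Type*} (Δ : V → A → V → ENNReal) (C : SubMDP V A) (v v' : V) : Prop :=
  v ∈ C.T ∧ v' ∈ C.T ∧ ∃ a ∈ C.act v, 0 < Δ v a v'

/-- End components: closed under the enabled actions, and strongly connected. -/
def SubMDP.IsEC {V A : Type*} (Δ : V → A → V → ENNReal) (C : SubMDP V A) : Prop :=
  (∀ v ∈ C.T, ∀ a ∈ C.act v, ∑ v' ∈ C.T, Δ v a v' = 1) ∧
    ∀ v ∈ C.T, ∀ v' ∈ C.T, Relation.ReflTransGen (C.Edge Δ) v v'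

/-- Accepting end components. -/
def SubMDP.IsAEC {V A : Type*} (Δ : V → A → V → ENNReal) (F : Set (Set V × Set V))
    (C : SubMDP V A) : Prop :=
  C.IsEC Δ ∧ ∃ p ∈ F, (C.T : Set V) ∩ p.1 ≠ ∅ ∧ (C.T : Set V) ∩ p.2 = ∅

/-- Accepting simple end components: exactly one action is enabled in every state. -/
def SubMDP.IsASEC {V A : Type*} (Δ : V → A → V → ENNReal) (F : Set (Set V × Set V))
    (C : SubMDP V A) : Prop :=
  C.IsAEC Δ F ∧ ∀ v ∈ C.T, (C.act v).card = 1

/-- `C_1, …, C_n` are accepting simple end components of the product MDP, and they cover all states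
that lie in some accepting simple end component. -/
def IsASECCover {S A Q AP : Type*} (P : TransFun S A) (L : S × A × S → Set AP) (D : DRA Q AP)
    {n : ℕ} (C : Fin n → SubMDP (S × Q) A) : Prop :=
  (∀ i, (C i).IsASEC (prodTrans P L D) (prodAcc S D)) ∧
    ∀ C' : SubMDP (S × Q) A, C'.IsASEC (prodTrans P L D) (prodAcc S D) →
      ∀ v ∈ C'.T, ∃ i, v ∈ (C i).T

/-! ### The reward machine of a family of components -/

/-- `v ∈ T_1 ∪ ⋯ ∪ T_n`. -/
def Covered {V A : Type*} {n : ℕ} (C : Fin n → SubMDP V A) (v : V) : Prop :=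
  ∃ i, v ∈ (C i).T

/-- For a covered `v`, the set `Act_v(v)` of actions enabled at `v` in the component `C_i`
containing `v` with `i` minimal. -/
def firstAct {V A : Type*} {n : ℕ} (C : Fin n → SubMDP V A) (v : V) : Set A :=
  {a | ∃ i, v ∈ (C i).T ∧ (∀ j < i, v ∉ (C j).T) ∧ a ∈ (C i).act v}

open Classical in
/-- The reward machine with states `Q ∪ {⊥}`, where `⊥` is `none`. It tracks the state of the DRA,
moves to the sink `⊥` when in a covered state an action outside `Act_v(v)` is taken, and rewards
with `1` the transitions from covered states (unless it is in `⊥`). -/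
def asecMachine {S A Q AP : Type*} (L : S × A × S → Set AP) (D : DRA Q AP)
    {n : ℕ} (C : Fin n → SubMDP (S × Q) A) : RewardMachine S A (Option Q) where
  init := some D.init
  upd
    | none, _ => none
    | some q, e =>
      if Covered C (e.1, q) ∧ e.2.1 ∉ firstAct C (e.1, q) then none else some (D.next q (L e))
  rew
    | none, _ => 0
    | some q, e => if Covered C (e.1, q) then 1 else 0

end RLSpec

end

/-!
Whether a family of components covers all accepting simple end components depends on the transition
function only through its support (`IsASECCover_congr`), because closedness of a component amounts
to its containing all successors of positive probability. One chosen component for every state lying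
in some gives a covering family of the required size (`exists_cover`).

For the comparison of the objectives, almost every run uses only transitions and actions of positive
probability (`ae_run_support`) and is fair: a product state that follows with positive probability a
state-action pair occurring infinitely often occurs infinitely often itself (`ae_fairRun`, from
Lévy's conditional Borel–Cantelli lemma). Along such a run the rewards are eventually constant
(`eventually_rewarded_or`), so that by dominated convergence the limit-average reward is the
probability of being rewarded from some time on (`limAvg_eq`).

A fair run rewarded forever ends up in a single component, whose states it all visits infinitely
often, and so it is accepted (`accepts_of_eventually_rewarded`); hence the limit-average reward is
at most the acceptance probability. Conversely, the state-action pairs occurring infinitely often in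
a fair accepted run form an accepting end component. A simple one inside it goes through an accepting
state (`exists_simple_endComponent`), so this state is covered, and the run reaches a covered state
(`DRA.Accepts.exists_covered`). Following the components from the first covered state on
(`coverPolicy`) leaves the probability of reaching a covered state unchanged
(`runMeasure_covered_eq`) and turns it into limit-average reward. These two inequalities imply that
maximisers of the limit average maximise the acceptance probability.
-/

namespace RLSpec

/-! ### Finite and infinite runs -/

section Runs

open Finset Preorder

variable {S A : Type*}

/-- The finite run `s_0 a_0 … a_{n-1} s_n` at the beginning of an infinite run. -/
def Run.fin (ρ : Run S A) (n : ℕ) : FinRun S A :=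
  finRunOfHist n (frestrictLe (π := fun _ => S × A) n ρ)

lemma Run.fin_zero (ρ : Run S A) : ρ.fin 0 = ((ρ 0).1, []) := rfl

lemma Run.fin_succ (ρ : Run S A) (n : ℕ) :
    ρ.fin (n + 1) = ((ρ.fin n).1, (ρ.fin n).2 ++ [((ρ n).2, (ρ (n + 1)).1)]) := by
  simp only [Run.fin, finRunOfHist, frestrictLe_apply, List.ofFn_succ', List.concat_eq_append,
    Fin.val_castSucc, Fin.val_last]

/-- `f ρ` only depends on the first `n + 1` state-action pairs of the run `ρ`. -/
def Adapted {X : Type*} (n : ℕ) (f : Run S A → X) : Prop :=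
  ∀ ρ ρ' : Run S A, (∀ i ≤ n, ρ i = ρ' i) → f ρ = f ρ'

lemma Adapted.preimage_eq {X : Type*} {n : ℕ} {f : Run S A → X} (hf : Adapted n f) (B : Set X) :
    f ⁻¹' B = frestrictLe (π := fun _ => S × A) n ⁻¹'
      (frestrictLe (π := fun _ => S × A) n '' (f ⁻¹' B)) := by
  refine (Set.subset_preimage_image _ _).antisymm ?_
  rintro ρ ⟨ρ', h', he⟩
  have : f ρ' = f ρ := hf _ _ fun i hi => congrFun he ⟨i, Finset.mem_Iic.2 hi⟩
  simpa [← this] using h'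

variable [Fintype S] [MeasurableSpace S] [MeasurableSingletonClass S]
  [Fintype A] [MeasurableSpace A] [MeasurableSingletonClass A]

lemma Adapted.measurableSet_piLE {X : Type*} {n : ℕ} {f : Run S A → X} (hf : Adapted n f)
    (B : Set X) : MeasurableSet[Filtration.piLE (X := fun _ => S × A) n] (f ⁻¹' B) := by
  -- the history space is finite, so every set of histories is measurable
  rw [hf.preimage_eq, Filtration.piLE_eq_comap_frestrictLe]
  exact ⟨_, MeasurableSet.of_discrete, rfl⟩

lemma Adapted.measurableSet {X : Type*} {n : ℕ} {f : Run S A → X} (hf : Adapted n f)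
    (B : Set X) : MeasurableSet (f ⁻¹' B) :=
  Filtration.piLE.le n _ (hf.measurableSet_piLE B)

end Runs

/-! ### The law of a run -/

section Law

open Finset Preorder

variable {S A : Type*}

lemma stepPMF_apply (M : MDP S A) (π : Policy S A) (n : ℕ) (ρ : Run S A) (x : S × A) :
    stepPMF M π n (frestrictLe (π := fun _ => S × A) n ρ) x =
      M.trans (ρ n).1 (ρ n).2 x.1 *
        π ((ρ.fin n).1, (ρ.fin n).2 ++ [((ρ n).2, x.1)]) x.2 := by
  classical
  obtain ⟨s', a'⟩ := x
  rw [stepPMF, PMF.bind_apply, tsum_eq_single s']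
  · congr 1
    rw [PMF.map_apply, tsum_eq_single a']
    · simp [Run.fin]
    · intro b hb
      simp [Ne.symm hb]
  · intro s hs
    simp [PMF.map_apply, Ne.symm hs]

/-- The state `s_{n+1}` has law `P(s_n, a_n, ·)`, whatever the policy does. -/
lemma stepPMF_map_fst (M : MDP S A) (π : Policy S A) (n : ℕ) (ρ : Run S A) :
    (stepPMF M π n (frestrictLe (π := fun _ => S × A) n ρ)).map Prod.fst =
      M.trans (ρ n).1 (ρ n).2 := by
  rw [stepPMF, PMF.map_bind]
  simp only [PMF.map_comp]
  have : ∀ s : S, (Prod.fst ∘ fun a : A => (s, a)) = Function.const A s := fun s => rfl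
  simp only [this, PMF.map_const]
  exact PMF.bind_pure _

variable [Fintype S] [MeasurableSpace S] [MeasurableSingletonClass S]
  [Fintype A] [MeasurableSpace A] [MeasurableSingletonClass A]

instance (M : MDP S A) (π : Policy S A) : IsProbabilityMeasure (runMeasure M π) := by
  have := PMF.toMeasure.isProbabilityMeasure (initPMF M π)
  unfold runMeasure; infer_instance

/-- The defining property of the Ionescu-Tulcea measure: the history up to time `n` and the pair
`(s_{n+1}, a_{n+1})` are jointly distributed as the one-step kernel prescribes. -/
lemma map_hist_compProd_stepKernel (M : MDP S A) (π : Policy S A) (n : ℕ) :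
    (runMeasure M π).map (frestrictLe n) ⊗ₘ stepKernel M π n =
      (runMeasure M π).map (fun ρ => (frestrictLe n ρ, ρ (n + 1))) := by
  have := PMF.toMeasure.isProbabilityMeasure (initPMF M π)
  exact Kernel.map_frestrictLe_trajMeasure_compProd_eq_map_trajMeasure

lemma map_runMeasure_zero (M : MDP S A) (π : Policy S A) :
    (runMeasure M π).map (fun ρ => ρ 0) = (initPMF M π).toMeasure := by
  have := PMF.toMeasure.isProbabilityMeasure (initPMF M π)
  have h : (fun ρ : Run S A => ρ 0) =
      (fun x : (i : Finset.Iic 0) → S × A => x ⟨0, Finset.mem_Iic.2 le_rfl⟩) ∘ frestrictLe 0 := rfl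
  rw [h, ← Measure.map_map (by fun_prop) (by fun_prop), runMeasure, Kernel.trajMeasure,
    Measure.map_comp _ _ (by fun_prop), Kernel.traj_map_frestrictLe, Kernel.partialTraj_self,
    Measure.id_comp, Measure.map_map (by fun_prop) (by fun_prop)]
  exact Measure.map_id

/-- A property of the history and the next pair that holds on the support of every one-step law
holds almost surely. -/
lemma ae_of_stepPMF (M : MDP S A) (π : Policy S A) (n : ℕ) (p : Run S A → Prop)
    (h : ∀ ρ, stepPMF M π n (frestrictLe (π := fun _ => S × A) n ρ) (ρ (n + 1)) ≠ 0 → p ρ) :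
    ∀ᵐ ρ ∂runMeasure M π, p ρ := by
  have key : ∀ᵐ z ∂((runMeasure M π).map
      (fun ρ : Run S A => (frestrictLe (π := fun _ => S × A) n ρ, ρ (n + 1)))),
      stepPMF M π n z.1 z.2 ≠ 0 := by
    rw [← map_hist_compProd_stepKernel, Measure.ae_compProd_iff MeasurableSet.of_discrete]
    refine Filter.Eventually.of_forall fun x => ?_
    change ∀ᵐ y ∂(stepPMF M π n x).toMeasure, _
    rw [ae_iff, PMF.toMeasure_apply_eq_zero_iff _ MeasurableSet.of_discrete]
    rw [Set.disjoint_left]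
    intro y hy hy'
    exact hy' hy
  have := ae_of_ae_map (by fun_prop) key
  filter_upwards [this] with ρ hρ using h ρ hρ

/-- Almost surely only transitions and actions of positive probability occur. -/
lemma ae_run_support (M : MDP S A) (π : Policy S A) :
    ∀ᵐ ρ ∂runMeasure M π, ∀ n, M.trans (ρ n).1 (ρ n).2 (ρ (n + 1)).1 ≠ 0 ∧
      π (ρ.fin n) (ρ n).2 ≠ 0 := by
  have h1 : ∀ᵐ ρ ∂runMeasure M π, ∀ n, M.trans (ρ n).1 (ρ n).2 (ρ (n + 1)).1 ≠ 0 ∧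
      π (ρ.fin (n + 1)) (ρ (n + 1)).2 ≠ 0 := by
    rw [ae_all_iff]
    intro n
    refine ae_of_stepPMF M π n _ fun ρ hρ => ?_
    rw [stepPMF_apply, ← Run.fin_succ] at hρ
    exact ⟨left_ne_zero_of_mul hρ, right_ne_zero_of_mul hρ⟩
  have h0 : ∀ᵐ ρ ∂runMeasure M π, initPMF M π (ρ 0) ≠ 0 := by
    have : ∀ᵐ x ∂((runMeasure M π).map (fun ρ => ρ 0)), initPMF M π x ≠ 0 := by
      rw [map_runMeasure_zero, ae_iff, PMF.toMeasure_apply_eq_zero_iff _ MeasurableSet.of_discrete,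
        Set.disjoint_left]
      exact fun y hy hy' => hy' hy
    exact ae_of_ae_map (measurable_pi_apply 0).aemeasurable this
  filter_upwards [h0, h1] with ρ h0 h1 n
  refine ⟨(h1 n).1, ?_⟩
  cases n with
  | zero =>
    rw [Run.fin_zero]
    have : ρ 0 ∈ (initPMF M π).support := h0
    rw [initPMF, PMF.support_map] at this
    obtain ⟨a, ha, he⟩ := this
    rw [← he]
    exact ha
  | succ n => exact (h1 n).2

/-- The event that a run agrees with `ρ` up to time `n`. -/
def cyl (n : ℕ) (ρ : Run S A) : Set (Run S A) :=
  {ρ' | frestrictLe (π := fun _ => S × A) n ρ' = frestrictLe n ρ}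

lemma runMeasure_inter_next (M : MDP S A) (π : Policy S A) (n : ℕ)
    (G : Set ((i : Finset.Iic n) → S × A)) (B : Set (S × A)) :
    runMeasure M π {ρ | frestrictLe n ρ ∈ G ∧ ρ (n + 1) ∈ B} =
      ∫⁻ h in G, (stepPMF M π n h).toMeasure B ∂(runMeasure M π).map (frestrictLe n) := by
  have h := congrArg (fun μ => μ (G ×ˢ B)) (map_hist_compProd_stepKernel M π n)
  beta_reduce at h
  rw [Measure.compProd_apply_prod MeasurableSet.of_discrete MeasurableSet.of_discrete,
    Measure.map_apply (by fun_prop) MeasurableSet.of_discrete] at h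
  exact h.symm

lemma runMeasure_cyl_succ (M : MDP S A) (π : Policy S A) (n : ℕ) (ρ : Run S A) :
    runMeasure M π (cyl (n + 1) ρ) = runMeasure M π (cyl n ρ) *
      (M.trans (ρ n).1 (ρ n).2 (ρ (n + 1)).1 * π (ρ.fin (n + 1)) (ρ (n + 1)).2) := by
  have h := runMeasure_inter_next M π n {frestrictLe n ρ} {ρ (n + 1)}
  rw [Measure.restrict_singleton, lintegral_smul_measure, lintegral_dirac,
    PMF.toMeasure_apply_singleton _ _ (measurableSet_singleton _), stepPMF_apply, ← Run.fin_succ,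
    Measure.map_apply (by fun_prop) (measurableSet_singleton _),
    smul_eq_mul] at h
  refine Eq.trans (congrArg _ ?_) h
  · ext ρ'
    simp only [cyl, Set.mem_ofPred_eq, Set.mem_singleton_iff]
    constructor
    · intro h'
      exact ⟨funext fun i => congrFun h' ⟨i, Finset.mem_Iic.2
        ((Finset.mem_Iic.1 i.2).trans n.le_succ)⟩, congrFun h' ⟨n + 1, Finset.mem_Iic.2 le_rfl⟩⟩
    · rintro ⟨h1, h2⟩
      funext ⟨i, hi⟩
      rcases (Finset.mem_Iic.1 hi).eq_or_lt with rfl | hlt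
      · exact h2
      · exact congrFun h1 ⟨i, Finset.mem_Iic.2 (Nat.lt_succ_iff.1 hlt)⟩

lemma runMeasure_cyl_zero (M : MDP S A) (π : Policy S A) (ρ : Run S A) :
    runMeasure M π (cyl 0 ρ) = initPMF M π (ρ 0) := by
  rw [← PMF.toMeasure_apply_singleton _ _ (measurableSet_singleton _), ← map_runMeasure_zero,
    Measure.map_apply (by fun_prop) (measurableSet_singleton _)]
  congr 1
  ext ρ'
  simp only [cyl, Set.mem_ofPred_eq, Set.mem_preimage, Set.mem_singleton_iff]
  refine ⟨fun h => congrFun h ⟨0, Finset.mem_Iic.2 le_rfl⟩, fun h => ?_⟩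
  funext ⟨i, hi⟩
  obtain rfl : i = 0 := Nat.le_zero.1 (Finset.mem_Iic.1 hi)
  exact h

/-- Two policies that agree along the runs of an event determined up to time `n` give it the same
probability. -/
lemma runMeasure_eq_of_agree (M : MDP S A) (π π' : Policy S A) (n : ℕ) (p : Run S A → Prop)
    (hp : Adapted n p)
    (h : ∀ ρ, (ρ 0).1 = M.init → p ρ → ∀ i ≤ n, π (ρ.fin i) = π' (ρ.fin i)) :
    runMeasure M π {ρ | p ρ} = runMeasure M π' {ρ | p ρ} := by
  classical
  have hcyl : ∀ ρ, p ρ → runMeasure M π (cyl n ρ) = runMeasure M π' (cyl n ρ) := by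
    intro ρ hρ
    by_cases h0 : (ρ 0).1 = M.init
    · have hi := h ρ h0 hρ
      suffices ∀ m ≤ n, runMeasure M π (cyl m ρ) = runMeasure M π' (cyl m ρ) from this n le_rfl
      intro m
      induction m with
      | zero =>
        intro _
        have := hi 0 (Nat.zero_le _)
        rw [Run.fin_zero, h0] at this
        rw [runMeasure_cyl_zero, runMeasure_cyl_zero, initPMF, initPMF, this]
      | succ m ih =>
        intro hm
        rw [runMeasure_cyl_succ, runMeasure_cyl_succ, ih (by omega), hi _ hm]
    -- a cylinder with the wrong initial state is null under every policy
    · have hz : ∀ π : Policy S A, runMeasure M π (cyl n ρ) = 0 := by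
        intro π
        refine measure_mono_null (t := cyl 0 ρ) ?_ ?_
        · intro ρ' h'
          funext ⟨i, hi⟩
          exact congrFun h' ⟨i, Finset.mem_Iic.2 ((Finset.mem_Iic.1 hi).trans (Nat.zero_le n))⟩
        · rw [runMeasure_cyl_zero, PMF.apply_eq_zero_iff, initPMF, PMF.support_map]
          rintro ⟨a, -, ha⟩
          exact h0 (by rw [← ha])
      rw [hz, hz]
  have hset : {ρ | p ρ} = frestrictLe (π := fun _ => S × A) n ⁻¹'
      (frestrictLe (π := fun _ => S × A) n '' {ρ | p ρ}).toFinite.toFinset := by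
    have := hp.preimage_eq {q | q}
    simpa using this
  rw [hset, ← Measure.map_apply (by fun_prop) MeasurableSet.of_discrete,
    ← Measure.map_apply (by fun_prop) MeasurableSet.of_discrete,
    ← sum_measure_singleton, ← sum_measure_singleton]
  refine Finset.sum_congr rfl fun x hx => ?_
  obtain ⟨ρ, hρ, rfl⟩ := (Set.Finite.mem_toFinset _).1 hx
  rw [Measure.map_apply (by fun_prop) (measurableSet_singleton _),
    Measure.map_apply (by fun_prop) (measurableSet_singleton _)]
  exact hcyl ρ hρ

/-- Conditional Borel–Cantelli for runs: if the events `p n`, determined up to time `n`, all force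
`(s_n, a_n) = (s, a)` and occur infinitely often, then infinitely often they are followed by any
given successor state of positive probability. -/
lemma ae_frequently_next (M : MDP S A) (π : Policy S A) (p : ℕ → Run S A → Prop)
    (hp : ∀ n, Adapted n (p n)) (s : S) (a : A) (s' : S)
    (hsa : ∀ n ρ, p n ρ → ρ n = (s, a)) (hpos : M.trans s a s' ≠ 0) :
    ∀ᵐ ρ ∂runMeasure M π, (∃ᶠ n in Filter.atTop, p n ρ) →
      ∃ᶠ n in Filter.atTop, p n ρ ∧ (ρ (n + 1)).1 = s' := by
  classical
  set μ := runMeasure M π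
  let ℱ := Filtration.piLE (X := fun _ : ℕ => S × A)
  -- `B (n + 1)`: the event `p n` occurs and is followed by `s'`; it is determined at time `n + 1`
  let B : ℕ → Set (Run S A)
    | 0 => ∅
    | n + 1 => {ρ | p n ρ ∧ (ρ (n + 1)).1 = s'}
  have hB : ∀ n, MeasurableSet[ℱ n] (B n) := by
    intro n
    cases n with
    | zero => exact @MeasurableSet.empty _ (ℱ 0)
    | succ n =>
      have : Adapted (n + 1) fun ρ : Run S A => p n ρ ∧ (ρ (n + 1)).1 = s' := by
        intro ρ ρ' h
        simp only [hp n ρ ρ' fun i hi => h i (by omega), h (n + 1) le_rfl]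
      have := this.measurableSet_piLE {q | q}
      exact this
  have hB' : ∀ n, MeasurableSet (B n) := fun n => ℱ.le n _ (hB n)
  set c : ℝ := (M.trans s a s').toReal with hc
  have hcpos : 0 < c := ENNReal.toReal_pos hpos (PMF.apply_ne_top _ _)
  have hH : ∀ n, MeasurableSet[ℱ n] {ρ | p n ρ} := fun n => (hp n).measurableSet_piLE {q | q}
  -- the conditional probability of `B (n + 1)` given the history up to time `n` is `c` on `p n`,
  -- and `0` elsewhere
  have hcond : ∀ n, (fun ρ => {ρ | p n ρ}.indicator (fun _ => c) ρ) =ᵐ[μ]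
      μ[(B (n + 1)).indicator (1 : Run S A → ℝ) | ℱ n] := by
    intro n
    refine ae_eq_condExp_of_forall_setIntegral_eq (ℱ.le n)
      ((integrable_indicator_iff (hB' (n + 1))).2 (integrable_const (1:ℝ)).integrableOn) ?_ ?_ ?_
    · intro G _ _
      exact ((integrable_indicator_iff (ℱ.le n _ (hH n))).2
        (integrable_const c).integrableOn).integrableOn
    · intro G hG _
      rw [integral_indicator (ℱ.le n _ (hH n)), integral_indicator (hB' (n + 1)),
        Measure.restrict_restrict (ℱ.le n _ (hH n)), Measure.restrict_restrict (hB' (n + 1))]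
      simp only [Pi.one_apply, integral_const, smul_eq_mul, measureReal_restrict_apply_univ,
        mul_one]
      have hG' := hG
      rw [show ℱ n = _ from Filtration.piLE_eq_comap_frestrictLe _] at hG'
      obtain ⟨G₀, -, rfl⟩ := hG'
      set H₀ := frestrictLe (π := fun _ => S × A) n '' {ρ | p n ρ}
      have hH₀ : {ρ | p n ρ} = frestrictLe (π := fun _ => S × A) n ⁻¹' H₀ := by
        have := (hp n).preimage_eq {q | q}
        exact this
      have e1 : B (n + 1) ∩ frestrictLe (π := fun _ => S × A) n ⁻¹' G₀ =
          {ρ | frestrictLe (π := fun _ => S × A) n ρ ∈ H₀ ∩ G₀ ∧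
            ρ (n + 1) ∈ Prod.fst ⁻¹' {s'}} := by
        ext ρ
        have : p n ρ ↔ frestrictLe (π := fun _ => S × A) n ρ ∈ H₀ := by
          have := Set.ext_iff.1 hH₀ ρ
          exact this
        change ((p n ρ ∧ (ρ (n + 1)).1 = s') ∧ frestrictLe n ρ ∈ G₀) ↔
          ((frestrictLe n ρ ∈ H₀ ∧ frestrictLe n ρ ∈ G₀) ∧ (ρ (n + 1)).1 = s')
        rw [this]
        tauto
      have e2 : μ (B (n + 1) ∩ frestrictLe (π := fun _ => S × A) n ⁻¹' G₀) =
          M.trans s a s' * μ ({ρ | p n ρ} ∩ frestrictLe (π := fun _ => S × A) n ⁻¹' G₀) := by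
        rw [e1, runMeasure_inter_next, setLIntegral_congr_fun (g := fun _ => M.trans s a s')
          MeasurableSet.of_discrete, setLIntegral_const,
          Measure.map_apply (by fun_prop) MeasurableSet.of_discrete, hH₀, Set.preimage_inter]
        rintro x ⟨⟨ρ, hρ, rfl⟩, -⟩
        have h2 := hsa n ρ hρ
        change (stepPMF M π n (frestrictLe n ρ)).toMeasure (Prod.fst ⁻¹' {s'}) = M.trans s a s'
        rw [← Measure.map_apply measurable_fst (measurableSet_singleton _),
          PMF.toMeasure_map _ _ measurable_fst, stepPMF_map_fst, h2,
          PMF.toMeasure_apply_singleton _ _ (measurableSet_singleton _)]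
      rw [measureReal_def, measureReal_def, e2, ENNReal.toReal_mul, mul_comm]
    · exact (stronglyMeasurable_const.indicator (hH n)).aestronglyMeasurable
  filter_upwards [ae_mem_limsup_atTop_iff (ℱ := ℱ) μ hB, ae_all_iff.2 hcond] with ρ h1 h2 h3
  have hlim : ρ ∈ Filter.limsup B Filter.atTop := by
    rw [h1]
    have e : ∀ n, ∑ k ∈ Finset.range n,
        (μ[(B (k + 1)).indicator (1 : Run S A → ℝ) | ℱ k]) ρ =
        c * ∑ k ∈ Finset.range n, {k | p k ρ}.indicator (1 : ℕ → ℝ) k := by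
      intro n
      rw [Finset.mul_sum]
      refine Finset.sum_congr rfl fun k _ => ?_
      rw [← h2 k]
      by_cases hk : p k ρ <;> simp [Set.indicator, hk]
    simp only [e]
    refine Filter.Tendsto.const_mul_atTop hcpos ?_
    have := Set.limsup_eq_tendsto_sum_indicator_atTop (R := ℝ) zero_lt_one
      (fun k => {ρ : Run S A | p k ρ})
    have hm : ρ ∈ Filter.limsup (fun k => {ρ : Run S A | p k ρ}) Filter.atTop := by
      rw [Filter.mem_limsup_iff_frequently_mem]
      exact h3
    rw [this] at hm
    exact hm
  rw [Filter.mem_limsup_iff_frequently_mem] at hlim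
  rw [Filter.frequently_atTop] at hlim ⊢
  intro N
  obtain ⟨m, hm, hmB⟩ := hlim (N + 1)
  obtain ⟨k, rfl⟩ : ∃ k, m = k + 1 := ⟨m - 1, by omega⟩
  exact ⟨k, by omega, hmB⟩

end Law

/-! ### End components of the product -/

section Product

variable {S A Q AP : Type*} {P P' : TransFun S A} {L : S × A × S → Set AP} {D : DRA Q AP}

lemma prodTrans_ne_zero_iff {v v' : S × Q} {a : A} :
    prodTrans P L D v a v' ≠ 0 ↔ D.next v.2 (L (v.1, a, v'.1)) = v'.2 ∧ P v.1 a v'.1 ≠ 0 := by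
  simp [prodTrans]

lemma supp_eq_iff : P.supp = P'.supp ↔ ∀ s a s', P s a s' ≠ 0 ↔ P' s a s' ≠ 0 := by
  simp [TransFun.supp, Set.ext_iff, pos_iff_ne_zero]

lemma prodTrans_ne_zero_congr (h : P.supp = P'.supp) {v v' : S × Q} {a : A} :
    prodTrans P L D v a v' ≠ 0 ↔ prodTrans P' L D v a v' ≠ 0 := by
  rw [prodTrans_ne_zero_iff, prodTrans_ne_zero_iff, supp_eq_iff.1 h]

variable [Fintype S] [Fintype Q]

lemma sum_prodTrans (v : S × Q) (a : A) : ∑ v', prodTrans P L D v a v' = 1 := by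
  classical
  rw [Fintype.sum_prod_type]
  simp only [prodTrans, Finset.sum_ite_eq, Finset.mem_univ, if_true]
  rw [← tsum_fintype (L := .unconditional S)]
  exact PMF.tsum_coe _

/-- Total probability `1` of staying in `T` only depends on the support. -/
lemma sum_prodTrans_eq_one_iff {T : Finset (S × Q)} {v : S × Q} {a : A} :
    ∑ v' ∈ T, prodTrans P L D v a v' = 1 ↔ ∀ v', prodTrans P L D v a v' ≠ 0 → v' ∈ T := by
  classical
  have h := Finset.sum_add_sum_compl T (prodTrans P L D v a)
  rw [sum_prodTrans] at h
  constructor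
  · intro h1 v' hv'
    by_contra hT
    rw [h1] at h
    have h0 : ∑ v' ∈ Tᶜ, prodTrans P L D v a v' = 0 :=
      (ENNReal.add_right_inj ENNReal.one_ne_top).1 (h.trans (add_zero 1).symm)
    exact hv' (Finset.sum_eq_zero_iff.1 h0 v' (Finset.mem_compl.2 hT))
  · intro h1
    rw [Finset.sum_eq_zero fun v' hv' => by_contra fun hne =>
      Finset.mem_compl.1 hv' (h1 v' hne), add_zero] at h
    exact h

lemma IsASEC_congr (h : P.supp = P'.supp) {F : Set (Set (S × Q) × Set (S × Q))}
    {C : SubMDP (S × Q) A} (hC : C.IsASEC (prodTrans P L D) F) :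
    C.IsASEC (prodTrans P' L D) F := by
  obtain ⟨⟨⟨h1, h2⟩, h3⟩, h4⟩ := hC
  refine ⟨⟨⟨fun v hv a ha => ?_, fun v hv v' hv' => ?_⟩, h3⟩, h4⟩
  · rw [sum_prodTrans_eq_one_iff]
    intro v' hv'
    exact sum_prodTrans_eq_one_iff.1 (h1 v hv a ha) v' ((prodTrans_ne_zero_congr h).2 hv')
  · refine Relation.ReflTransGen.mono ?_ _ _ (h2 v hv v' hv')
    rintro x y ⟨hx, hy, a, ha, hp⟩
    exact ⟨hx, hy, a, ha, pos_iff_ne_zero.2 ((prodTrans_ne_zero_congr h).1 hp.ne')⟩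

/-- Being a covering family only depends on the support of the transition function. -/
lemma IsASECCover_congr (h : P.supp = P'.supp) {n : ℕ} {C : Fin n → SubMDP (S × Q) A}
    (hC : IsASECCover P L D C) : IsASECCover P' L D C :=
  ⟨fun i => IsASEC_congr h (hC.1 i), fun C' hC' => hC.2 C' (IsASEC_congr h.symm hC')⟩

/-- Choosing one accepting simple end component for every state lying in some gives a covering
family. -/
lemma exists_cover (P : TransFun S A) (L : S × A × S → Set AP) (D : DRA Q AP) :
    ∃ n ≤ Fintype.card (S × Q), ∃ C : Fin n → SubMDP (S × Q) A, IsASECCover P L D C := by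
  classical
  let p : S × Q → Prop := fun v => ∃ C : SubMDP (S × Q) A,
    C.IsASEC (prodTrans P L D) (prodAcc S D) ∧ v ∈ C.T
  let e := Fintype.equivFin {v // p v}
  refine ⟨_, Fintype.card_subtype_le p, fun i => (e.symm i).2.choose,
    fun i => (e.symm i).2.choose_spec.1, fun C' hC' v hv => ⟨e ⟨v, C', hC', hv⟩, ?_⟩⟩
  have := (e.symm (e ⟨v, C', hC', hv⟩)).2.choose_spec.2
  convert this using 1
  simp

lemma SubMDP.IsEC.next_mem {C : SubMDP (S × Q) A} (hC : C.IsEC (prodTrans P L D)) {v : S × Q}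
    {a : A} {s' : S} (hv : v ∈ C.T) (ha : a ∈ C.act v) (hp : P v.1 a s' ≠ 0) :
    (s', D.next v.2 (L (v.1, a, s'))) ∈ C.T :=
  sum_prodTrans_eq_one_iff.1 (hC.1 v hv a ha) _ (prodTrans_ne_zero_iff.2 ⟨rfl, hp⟩)

/-- A set `I` of state-action pairs whose states form a closed set `T`, from every state of which
`v₀` is reachable through `I`, contains a simple end component through `v₀`: in every state other
than `v₀` play an action of `I` that may bring `v₀` closer, in `v₀` any action of `I`, and keep the
states reachable from `v₀`. -/
lemma exists_simple_endComponent (I : Set ((S × Q) × A)) (v₀ : S × Q)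
    (hv₀ : ∃ a, (v₀, a) ∈ I)
    (hclosed : ∀ v a v', (v, a) ∈ I → prodTrans P L D v a v' ≠ 0 → ∃ a', (v', a') ∈ I)
    (hconn : ∀ v a, (v, a) ∈ I →
      Relation.ReflTransGen (fun v v' => ∃ a, (v, a) ∈ I ∧ prodTrans P L D v a v' ≠ 0) v v₀) :
    ∃ C : SubMDP (S × Q) A, C.IsEC (prodTrans P L D) ∧ (∀ v ∈ C.T, (C.act v).card = 1) ∧
      v₀ ∈ C.T ∧ ∀ v ∈ C.T, ∃ a, (v, a) ∈ I := by
  classical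
  -- `reach k v`: there is a path of length `k` from `v` to `v₀`
  let reach : ℕ → S × Q → Prop := fun k => Nat.rec (fun v => v = v₀)
    (fun _ r v => ∃ v', (∃ a, (v, a) ∈ I ∧ prodTrans P L D v a v' ≠ 0) ∧ r v') k
  have hreach : ∀ v a, (v, a) ∈ I → ∃ k, reach k v := by
    intro v a hv
    refine (hconn v a hv).head_induction_on ⟨0, rfl⟩ ?_
    rintro x y hxy - ⟨k, hk⟩
    exact ⟨k + 1, y, hxy, hk⟩
  let d : S × Q → ℕ := fun v => sInf {k | reach k v}
  have hstep : ∀ v, (∃ a, (v, a) ∈ I) → ∃ a, (v, a) ∈ I ∧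
      (v ≠ v₀ → ∃ v', prodTrans P L D v a v' ≠ 0 ∧ d v' < d v) := by
    rintro v ⟨a, ha⟩
    by_cases hv : v = v₀
    · exact ⟨a, ha, fun h => absurd hv h⟩
    · have hmem : reach (d v) v := Nat.sInf_mem (hreach v a ha)
      cases hd : d v with
      | zero => rw [hd] at hmem; exact absurd hmem hv
      | succ k =>
        rw [hd] at hmem
        obtain ⟨v', ⟨b, hb, hp⟩, hk⟩ := hmem
        exact ⟨b, hb, fun _ => ⟨v', hp, Nat.lt_succ_of_le (Nat.sInf_le hk)⟩⟩
  obtain ⟨a₀, ha₀⟩ := hv₀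
  let f : S × Q → A := fun v => if h : ∃ a, (v, a) ∈ I then (hstep v h).choose else a₀
  have hf : ∀ v, (∃ a, (v, a) ∈ I) → (v, f v) ∈ I ∧
      (v ≠ v₀ → ∃ v', prodTrans P L D v (f v) v' ≠ 0 ∧ d v' < d v) := by
    intro v h
    simp only [f, dif_pos h]
    exact (hstep v h).choose_spec
  let R : S × Q → S × Q → Prop := fun v v' => prodTrans P L D v (f v) v' ≠ 0
  let C : SubMDP (S × Q) A :=
    { T := Finset.univ.filter fun v => Relation.ReflTransGen R v₀ v, act := fun v => {f v} }
  have hT : ∀ v, v ∈ C.T ↔ Relation.ReflTransGen R v₀ v := fun v => by simp [C]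
  have hI : ∀ v, v ∈ C.T → ∃ a, (v, a) ∈ I := by
    intro v hv
    rw [hT] at hv
    induction hv with
    | refl => exact ⟨a₀, ha₀⟩
    | tail _ hR ih => exact hclosed _ _ _ (hf _ ih).1 hR
  have hedge : ∀ v v', v ∈ C.T → R v v' → C.Edge (prodTrans P L D) v v' := by
    intro v v' hv hR
    exact ⟨hv, (hT v').2 (((hT v).1 hv).tail hR), f v, Finset.mem_singleton_self _,
      pos_iff_ne_zero.2 hR⟩
  have hto : ∀ k v, d v = k → v ∈ C.T → Relation.ReflTransGen (C.Edge (prodTrans P L D)) v v₀ := by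
    intro k
    induction k using Nat.strong_induction_on with
    | _ k ih =>
      intro v hd hv
      by_cases h0 : v = v₀
      · rw [h0]
      · obtain ⟨v', hp, hlt⟩ := (hf v (hI v hv)).2 h0
        have he := hedge v v' hv hp
        exact Relation.ReflTransGen.head he (ih _ (hd ▸ hlt) v' rfl he.2.1)
  have hfrom : ∀ v, v ∈ C.T → Relation.ReflTransGen (C.Edge (prodTrans P L D)) v₀ v := by
    intro v hv
    rw [hT] at hv
    induction hv with
    | refl => exact .refl
    | tail h hR ih => exact ih.tail (hedge _ _ ((hT _).2 h) hR)
  refine ⟨C, ⟨fun v hv a ha => ?_, fun v hv v' hv' => (hto _ v rfl hv).trans (hfrom v' hv')⟩,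
    fun v _ => Finset.card_singleton _, (hT _).2 .refl, hI⟩
  obtain rfl : a = f v := Finset.mem_singleton.1 ha
  rw [sum_prodTrans_eq_one_iff]
  exact fun v' hv' => (hedge v v' hv hv').2.1

end Product

/-! ### The product states along a run -/

section ProductRun

variable {S A Q AP : Type*}

/-- The sequence of states of the product MDP visited by a run. -/
def prodSeq (L : S × A × S → Set AP) (D : DRA Q AP) (ρ : Run S A) (n : ℕ) : S × Q :=
  ((ρ n).1, D.stateSeq (fun i => L (ρ.trans i)) n)

/-- The state of the product MDP at the end of a finite run. -/
def FinRun.prodState (L : S × A × S → Set AP) (D : DRA Q AP) (r : FinRun S A) : S × Q :=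
  r.2.foldl (fun v x => (x.2, D.next v.2 (L (v.1, x.1, x.2)))) (r.1, D.init)

variable (L : S × A × S → Set AP) (D : DRA Q AP)

lemma prodSeq_succ (ρ : Run S A) (n : ℕ) :
    prodSeq L D ρ (n + 1) = ((ρ (n + 1)).1,
      D.next (prodSeq L D ρ n).2 (L ((prodSeq L D ρ n).1, (ρ n).2, (ρ (n + 1)).1))) := rfl

lemma prodState_fin (ρ : Run S A) (n : ℕ) :
    FinRun.prodState L D (ρ.fin n) = prodSeq L D ρ n := by
  induction n with
  | zero => rfl
  | succ n ih =>
    rw [Run.fin_succ, FinRun.prodState, List.foldl_append, prodSeq_succ, ← ih]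
    rfl

lemma adapted_prodSeq (n : ℕ) : Adapted n fun ρ : Run S A => prodSeq L D ρ n := by
  intro ρ ρ' h
  induction n with
  | zero => simp [prodSeq, h 0 le_rfl, DRA.stateSeq]
  | succ n ih =>
    have ih := ih fun i hi => h i (by omega)
    beta_reduce at ih ⊢
    rw [prodSeq_succ, prodSeq_succ, ih, h n (by omega), h (n + 1) le_rfl]

lemma prodTrans_prodSeq {P : TransFun S A} {ρ : Run S A} {n : ℕ}
    (h : P (ρ n).1 (ρ n).2 (ρ (n + 1)).1 ≠ 0) :
    prodTrans P L D (prodSeq L D ρ n) (ρ n).2 (prodSeq L D ρ (n + 1)) ≠ 0 :=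
  prodTrans_ne_zero_iff.2 ⟨rfl, h⟩

/-- Product states that follow, with positive probability, a state-action pair occurring infinitely
often occur infinitely often themselves. -/
def FairRun (P : TransFun S A) (ρ : Run S A) : Prop :=
  ∀ v a v', prodTrans P L D v a v' ≠ 0 →
    (∃ᶠ n in Filter.atTop, prodSeq L D ρ n = v ∧ (ρ n).2 = a) →
    ∃ᶠ n in Filter.atTop, prodSeq L D ρ n = v'

lemma ae_fairRun [Finite Q] [Fintype S] [MeasurableSpace S] [MeasurableSingletonClass S]
    [Fintype A] [MeasurableSpace A] [MeasurableSingletonClass A] (M : MDP S A) (π : Policy S A) :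
    ∀ᵐ ρ ∂runMeasure M π, FairRun L D M.trans ρ := by
  simp only [FairRun, ae_all_iff]
  intro v a v' hp
  rw [prodTrans_ne_zero_iff] at hp
  have h := ae_frequently_next M π (fun n ρ => prodSeq L D ρ n = v ∧ (ρ n).2 = a) ?_ v.1 a v'.1
    ?_ hp.2
  · filter_upwards [h] with ρ h h'
    have := h h'
    rw [Filter.frequently_atTop] at this ⊢
    intro N
    obtain ⟨n, hn, ⟨h1, h2⟩, h3⟩ := this N
    refine ⟨n + 1, by omega, ?_⟩
    rw [prodSeq_succ, h1, h2, h3, hp.1]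
  · intro n ρ ρ' hi
    have := adapted_prodSeq L D n ρ ρ' hi
    beta_reduce at this ⊢
    rw [this, hi n le_rfl]
  · rintro n ρ ⟨rfl, rfl⟩
    rfl

lemma exists_frequently_eq {X : Type*} [Finite X] {p : ℕ → Prop} (x : ℕ → X)
    (h : ∃ᶠ n in Filter.atTop, p n) : ∃ y, ∃ᶠ n in Filter.atTop, p n ∧ x n = y := by
  by_contra hcon
  simp only [not_exists, Filter.not_frequently, not_and] at hcon
  rw [← Filter.eventually_all] at hcon
  exact h (hcon.mono fun n hn hp => hn (x n) hp rfl)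

/-- The states and actions occurring infinitely often in an accepted run form an accepting end
component, which contains an accepting simple one. -/
lemma DRA.Accepts.exists_covered [Fintype S] [Finite A] [Fintype Q] {P : TransFun S A} {m : ℕ}
    {C : Fin m → SubMDP (S × Q) A} (hC : IsASECCover P L D C) {ρ : Run S A}
    (hacc : D.Accepts fun i => L (ρ.trans i)) (hfair : FairRun L D P ρ)
    (hsupp : ∀ n, P (ρ n).1 (ρ n).2 (ρ (n + 1)).1 ≠ 0) :
    ∃ n, Covered C (prodSeq L D ρ n) := by
  obtain ⟨p, hp, hA, hR⟩ := hacc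
  obtain ⟨q, hq, hqp⟩ := Set.nonempty_iff_ne_empty.2 hA
  -- the state-action pairs occurring infinitely often
  let I : Set ((S × Q) × A) :=
    {x | ∃ᶠ n in Filter.atTop, prodSeq L D ρ n = x.1 ∧ (ρ n).2 = x.2}
  have hI : ∀ v, (∃ᶠ n in Filter.atTop, prodSeq L D ρ n = v) → ∃ a, (v, a) ∈ I := fun v hv =>
    exists_frequently_eq (fun n => (ρ n).2) hv
  have hI' : ∀ x ∈ I, ∃ᶠ n in Filter.atTop, prodSeq L D ρ n = x.1 := fun x hx =>
    hx.mono fun n hn => hn.1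
  obtain ⟨s, hs⟩ := exists_frequently_eq (fun n => (ρ n).1) hq
  have hv₀ : ∃ᶠ n in Filter.atTop, prodSeq L D ρ n = (s, q) :=
    hs.mono fun n hn => Prod.ext hn.2 hn.1
  have hev : ∀ᶠ n in Filter.atTop, (prodSeq L D ρ n, (ρ n).2) ∈ I := by
    have : ∀ᶠ n in Filter.atTop, ∀ x : (S × Q) × A, x ∉ I →
        ¬ (prodSeq L D ρ n = x.1 ∧ (ρ n).2 = x.2) := by
      rw [Filter.eventually_all]
      intro x
      by_cases hx : x ∈ I
      · exact Filter.Eventually.of_forall fun n h => absurd hx h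
      · exact (Filter.not_frequently.1 hx).mono fun n hn _ => hn
    filter_upwards [this] with n hn
    by_contra hcon
    exact hn _ hcon ⟨rfl, rfl⟩
  obtain ⟨N, hN⟩ := Filter.eventually_atTop.1 hev
  -- the run itself provides paths through `I` between its recurrent states
  have hpath : ∀ n, N ≤ n → ∀ k, Relation.ReflTransGen
      (fun v v' => ∃ a, (v, a) ∈ I ∧ prodTrans P L D v a v' ≠ 0)
      (prodSeq L D ρ n) (prodSeq L D ρ (n + k)) := by
    intro n hn k
    induction k with
    | zero => exact .refl
    | succ k ih =>
      exact ih.tail ⟨_, hN _ (by omega), prodTrans_prodSeq L D (hsupp (n + k))⟩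
  obtain ⟨C', hEC, hcard, hmem, hCI⟩ := exists_simple_endComponent (P := P) (L := L) (D := D)
    I (s, q) (hI _ hv₀)
    (fun v a v' hva hp => hI _ (hfair v a v' hp hva)) (by
      intro v a hva
      obtain ⟨n, hn, rfl⟩ := Filter.frequently_atTop.1 (hI' _ hva) N
      obtain ⟨k, hk, hk'⟩ := Filter.frequently_atTop.1 hv₀ n
      obtain ⟨j, rfl⟩ := Nat.exists_eq_add_of_le hk
      rw [← hk']
      exact hpath n hn j)
  have hASEC : C'.IsASEC (prodTrans P L D) (prodAcc S D) := by
    refine ⟨⟨hEC, _, ⟨p, hp, rfl⟩, ?_, ?_⟩, hcard⟩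
    · exact Set.nonempty_iff_ne_empty.1 ⟨(s, q), hmem, Set.mem_univ _, hqp⟩
    · rw [Set.eq_empty_iff_forall_notMem]
      rintro v ⟨hv, -, hvR⟩
      obtain ⟨a, ha⟩ := hCI v hv
      refine Set.eq_empty_iff_forall_notMem.1 hR v.2 ⟨?_, hvR⟩
      exact (hI' _ ha).mono fun n hn => congrArg Prod.snd hn
  obtain ⟨n, hn⟩ := hv₀.exists
  obtain ⟨i, hi⟩ := hC.2 C' hASEC _ hmem
  exact ⟨n, i, hn ▸ hi⟩

end ProductRun

/-! ### The reward machine along a run -/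

section Machine

variable {S A Q AP : Type*} {m : ℕ}

/-- At time `n` the reward machine is not in the sink and the product state is covered; these are
the times with reward `1`. -/
def Rewarded (L : S × A × S → Set AP) (D : DRA Q AP) (C : Fin m → SubMDP (S × Q) A)
    (ρ : Run S A) (n : ℕ) : Prop :=
  (asecMachine L D C).stateSeq ρ n ≠ none ∧ Covered C (prodSeq L D ρ n)

variable {L : S × A × S → Set AP} {D : DRA Q AP} {C : Fin m → SubMDP (S × Q) A}

lemma asecMachine_stateSeq (ρ : Run S A) (n : ℕ) (h : (asecMachine L D C).stateSeq ρ n ≠ none) :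
    (asecMachine L D C).stateSeq ρ n = some (prodSeq L D ρ n).2 := by
  induction n with
  | zero => rfl
  | succ n ih =>
    rw [RewardMachine.stateSeq] at h ⊢
    by_cases hn : (asecMachine L D C).stateSeq ρ n = none
    · rw [hn] at h
      exact absurd rfl h
    · rw [ih hn] at h ⊢
      simp only [asecMachine] at h ⊢
      split_ifs at h ⊢
      · exact absurd rfl h
      · rfl

lemma asecMachine_stateSeq_succ_ne_none_iff (ρ : Run S A) (n : ℕ) :
    (asecMachine L D C).stateSeq ρ (n + 1) ≠ none ↔
      (asecMachine L D C).stateSeq ρ n ≠ none ∧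
        (Covered C (prodSeq L D ρ n) → (ρ n).2 ∈ firstAct C (prodSeq L D ρ n)) := by
  rw [RewardMachine.stateSeq]
  by_cases hn : (asecMachine L D C).stateSeq ρ n = none
  · rw [hn]
    simp [asecMachine]
  · rw [asecMachine_stateSeq ρ n hn]
    classical
    change (if Covered C (prodSeq L D ρ n) ∧ (ρ n).2 ∉ firstAct C (prodSeq L D ρ n) then _
      else _) ≠ none ↔ _
    split_ifs with h
    · simpa using h
    · simpa using h

open Classical in
lemma asecMachine_rew (ρ : Run S A) (n : ℕ) :
    (asecMachine L D C).rew ((asecMachine L D C).stateSeq ρ n) (ρ.trans n) =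
      if Rewarded L D C ρ n then 1 else 0 := by
  by_cases hn : (asecMachine L D C).stateSeq ρ n = none
  · rw [if_neg fun h : Rewarded L D C ρ n => h.1 hn, hn]
    rfl
  · have h : Rewarded L D C ρ n ↔ Covered C (prodSeq L D ρ n) := by simp [Rewarded, hn]
    rw [asecMachine_stateSeq ρ n hn]
    simp only [h]
    rfl

lemma asecMachine_stateSeq_antitone (ρ : Run S A) {k n : ℕ} (hkn : k ≤ n)
    (h : (asecMachine L D C).stateSeq ρ n ≠ none) : (asecMachine L D C).stateSeq ρ k ≠ none := by
  induction n, hkn using Nat.le_induction with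
  | base => exact h
  | succ n _ ih => exact ih ((asecMachine_stateSeq_succ_ne_none_iff ρ n).1 h).1

lemma Covered.firstAct_nonempty (hcard : ∀ i, ∀ v ∈ (C i).T, ((C i).act v).card = 1) {v : S × Q}
    (h : Covered C v) : ∃ a, a ∈ firstAct C v := by
  obtain ⟨i, hi, hmin⟩ := wellFounded_lt.has_min {i | v ∈ (C i).T} h
  obtain ⟨a, ha⟩ := Finset.card_pos.1 (by rw [hcard i v hi]; exact one_pos)
  exact ⟨a, i, hi, fun j hj hjT => hmin j hjT hj, ha⟩

lemma adapted_rewarded (n : ℕ) :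
    Adapted n fun ρ : Run S A => Rewarded L D C ρ n := by
  have hstate : ∀ n, Adapted n fun ρ : Run S A => (asecMachine L D C).stateSeq ρ n ≠ none := by
    intro n ρ ρ' h
    beta_reduce
    induction n with
    | zero => rfl
    | succ n ih =>
      have hp := adapted_prodSeq L D n ρ ρ' fun i hi => h i (by omega)
      beta_reduce at hp
      rw [asecMachine_stateSeq_succ_ne_none_iff, asecMachine_stateSeq_succ_ne_none_iff,
        ih fun i hi => h i (by omega), hp, h n (by omega)]
  intro ρ ρ' h
  have h1 := hstate n ρ ρ' h
  have h2 := adapted_prodSeq L D n ρ ρ' h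
  simp only [Rewarded] at h1 h2 ⊢
  rw [h1, h2]

variable [Fintype S] [Fintype Q] {P : TransFun S A} {ρ : Run S A}

/-- The action of the first component that contains the current state does not leave the
component. -/
lemma mem_next_of_mem_act (hC : IsASECCover P L D C)
    (hsupp : ∀ n, P (ρ n).1 (ρ n).2 (ρ (n + 1)).1 ≠ 0) {n : ℕ} {i : Fin m}
    (h : prodSeq L D ρ n ∈ (C i).T) (ha : (ρ n).2 ∈ (C i).act (prodSeq L D ρ n)) :
    prodSeq L D ρ (n + 1) ∈ (C i).T := by
  rw [prodSeq_succ]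
  exact (hC.1 i).1.1.next_mem h ha (hsupp n)

lemma Rewarded.succ (hC : IsASECCover P L D C)
    (hsupp : ∀ n, P (ρ n).1 (ρ n).2 (ρ (n + 1)).1 ≠ 0) {n : ℕ} (h : Rewarded L D C ρ n)
    (hn : (asecMachine L D C).stateSeq ρ (n + 1) ≠ none) : Rewarded L D C ρ (n + 1) := by
  obtain ⟨i, hi, -, ha⟩ := ((asecMachine_stateSeq_succ_ne_none_iff ρ n).1 hn).2 h.2
  exact ⟨hn, i, mem_next_of_mem_act hC hsupp hi ha⟩

/-- Rewards are eventually constant: from the first reward on they last until the machine enters the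
sink, which it never leaves. -/
lemma eventually_rewarded_or (hC : IsASECCover P L D C)
    (hsupp : ∀ n, P (ρ n).1 (ρ n).2 (ρ (n + 1)).1 ≠ 0) :
    (∀ᶠ n in Filter.atTop, Rewarded L D C ρ n) ∨ ∀ᶠ n in Filter.atTop, ¬ Rewarded L D C ρ n := by
  by_cases h : ∃ k, (asecMachine L D C).stateSeq ρ k = none
  · obtain ⟨k, hk⟩ := h
    refine Or.inr (Filter.eventually_atTop.2 ⟨k, fun n hn hr => ?_⟩)
    exact asecMachine_stateSeq_antitone ρ hn hr.1 hk
  · push Not at h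
    by_cases h' : ∃ k, Rewarded L D C ρ k
    · obtain ⟨k, hk⟩ := h'
      refine Or.inl (Filter.eventually_atTop.2 ⟨k, fun n hn => ?_⟩)
      induction n, hn using Nat.le_induction with
      | base => exact hk
      | succ n _ ih => exact ih.succ hC hsupp (h _)
    · push Not at h'
      exact Or.inr (Filter.Eventually.of_forall h')

/-- A fair run that is rewarded forever stays in one component from some time on, playing its
actions: the least index of a component containing the current state never increases. By fairness
it visits all states of this accepting component infinitely often. -/
lemma accepts_of_eventually_rewarded (hC : IsASECCover P L D C)
    (hsupp : ∀ n, P (ρ n).1 (ρ n).2 (ρ (n + 1)).1 ≠ 0) (hfair : FairRun L D P ρ)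
    (h : ∀ᶠ n in Filter.atTop, Rewarded L D C ρ n) : D.Accepts fun i => L (ρ.trans i) := by
  obtain ⟨N, hN⟩ := Filter.eventually_atTop.1 h
  have hact : ∀ k, (ρ (N + k)).2 ∈ firstAct C (prodSeq L D ρ (N + k)) := fun k =>
    ((asecMachine_stateSeq_succ_ne_none_iff ρ (N + k)).1 (hN (N + k + 1) (by omega)).1).2
      (hN (N + k) (by omega)).2
  choose idx hidx hmin hidxact using hact
  have hanti : Antitone idx := antitone_nat_of_succ_le fun k => not_lt.1 fun hlt =>
    hmin (k + 1) _ hlt (mem_next_of_mem_act hC hsupp (hidx k) (hidxact k))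
  obtain ⟨-, ⟨K, rfl⟩, hK⟩ := wellFounded_lt.has_min (Set.range idx) ⟨_, 0, rfl⟩
  -- `K` minimises `idx`, and `idx` is antitone
  have hconst : ∀ k, K ≤ k → idx k = idx K := fun k hk =>
    (hanti hk).eq_of_not_lt (hK _ ⟨k, rfl⟩)
  set i := idx K
  have hstay : ∀ n, N + K ≤ n → prodSeq L D ρ n ∈ (C i).T ∧
      (ρ n).2 ∈ (C i).act (prodSeq L D ρ n) := by
    intro n hn
    obtain ⟨k, rfl⟩ := Nat.exists_eq_add_of_le (show N ≤ n by omega)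
    rw [← hconst k (by omega)]
    exact ⟨hidx k, hidxact k⟩
  obtain ⟨⟨hEC, pV, ⟨p, hp, rfl⟩, hA, hR⟩, hcard⟩ := hC.1 i
  obtain ⟨v₁, hv₁⟩ := exists_frequently_eq (p := fun _ => True) (prodSeq L D ρ)
    (Filter.Eventually.of_forall fun _ => trivial).frequently
  replace hv₁ := hv₁.mono fun n hn => hn.2
  have hv₁T : v₁ ∈ (C i).T := by
    obtain ⟨n, hn, rfl⟩ := Filter.frequently_atTop.1 hv₁ (N + K)
    exact (hstay n hn).1
  have hall : ∀ v ∈ (C i).T, ∃ᶠ n in Filter.atTop, prodSeq L D ρ n = v := by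
    intro v hv
    have := hEC.2 v₁ hv₁T v hv
    induction this with
    | refl => exact hv₁
    | @tail x y _ hxy ih =>
      obtain ⟨hx, -, a, ha, hpos⟩ := hxy
      refine hfair x a y hpos.ne' ?_
      have hev : ∀ᶠ n in Filter.atTop, N + K ≤ n := Filter.eventually_ge_atTop _
      refine ((ih hx).and_eventually hev).mono ?_
      rintro n ⟨rfl, hn⟩
      exact ⟨rfl, Finset.card_le_one.1 (hcard _ hx).le _ (hstay n hn).2 _ ha⟩
  refine ⟨p, hp, ?_, ?_⟩
  · obtain ⟨v, hv, -, hvp⟩ := Set.nonempty_iff_ne_empty.2 hA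
    exact Set.nonempty_iff_ne_empty.1
      ⟨v.2, (hall v hv).mono fun n hn => congrArg Prod.snd hn, hvp⟩
  · rw [Set.eq_empty_iff_forall_notMem]
    rintro q ⟨hq, hqp⟩
    obtain ⟨n, hn, hnq⟩ := Filter.frequently_atTop.1 hq (N + K)
    refine Set.eq_empty_iff_forall_notMem.1 hR _ ⟨(hstay n hn).1, Set.mem_univ _, ?_⟩
    change D.stateSeq (fun i => L (ρ.trans i)) n ∈ p.2
    rwa [hnq]

end Machine

/-! ### Comparison of the two objectives -/

section Values

variable {S A Q AP : Type*} [Fintype S] [MeasurableSpace S] [MeasurableSingletonClass S]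
  [Fintype A] [MeasurableSpace A] [MeasurableSingletonClass A] {m : ℕ}
  {M : MDP S A} {L : S × A × S → Set AP} {D : DRA Q AP} {C : Fin m → SubMDP (S × Q) A}

lemma measurableSet_rewarded (n : ℕ) : MeasurableSet {ρ : Run S A | Rewarded L D C ρ n} :=
  (adapted_rewarded n).measurableSet {q | q}

lemma measurableSet_eventually_rewarded :
    MeasurableSet {ρ : Run S A | ∀ᶠ n in Filter.atTop, Rewarded L D C ρ n} := by
  have : {ρ : Run S A | ∀ᶠ n in Filter.atTop, Rewarded L D C ρ n} =
      ⋃ N, ⋂ n, ⋂ (_ : N ≤ n), {ρ : Run S A | Rewarded L D C ρ n} := by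
    ext ρ
    simp [Filter.eventually_atTop]
  rw [this]
  exact .iUnion fun N => .iInter fun n => .iInter fun _ => measurableSet_rewarded n

open Classical in
/-- The policy that plays the action of the first component containing the current product state,
and follows `π` as long as there is none. -/
noncomputable def coverPolicy (L : S × A × S → Set AP) (D : DRA Q AP) (C : Fin m → SubMDP (S × Q) A)
    (π : Policy S A) : Policy S A := fun r =>
  if h : ∃ a, a ∈ firstAct C (FinRun.prodState L D r) then PMF.pure h.choose else π r

/-- `π` and `coverPolicy` reach a covered state with the same probability, as they only differ
from then on. -/
lemma runMeasure_covered_eq (M : MDP S A) (L : S × A × S → Set AP) (D : DRA Q AP)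
    (C : Fin m → SubMDP (S × Q) A) (π : Policy S A) :
    runMeasure M π {ρ | ∃ n, Covered C (prodSeq L D ρ n)} =
      runMeasure M (coverPolicy L D C π) {ρ | ∃ n, Covered C (prodSeq L D ρ n)} := by
  let U : ℕ → Set (Run S A) := fun n => {ρ | ∀ i ≤ n, ¬ Covered C (prodSeq L D ρ i)}
  have hadapt : ∀ n, Adapted n fun ρ : Run S A => ∀ i ≤ n, ¬ Covered C (prodSeq L D ρ i) := by
    intro n ρ ρ' h
    refine propext (forall₂_congr fun i hi => ?_)
    have := adapted_prodSeq L D i ρ ρ' fun j hj => h j (hj.trans hi)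
    beta_reduce at this
    rw [this]
  have hU : ∀ n, MeasurableSet (U n) := fun n => (hadapt n).measurableSet {q | q}
  have hunion : {ρ : Run S A | ∃ n, Covered C (prodSeq L D ρ n)} = ⋃ n, (U n)ᶜ := by
    ext ρ
    simp only [U, Set.mem_ofPred_eq, Set.mem_iUnion, Set.mem_compl_iff, not_forall, not_not]
    exact ⟨fun ⟨n, hn⟩ => ⟨n, n, le_rfl, hn⟩, fun ⟨_, i, _, hi⟩ => ⟨i, hi⟩⟩
  have hmono : Monotone fun n => (U n)ᶜ := fun a b hab =>
    Set.compl_subset_compl.2 fun ρ hρ i hi => hρ i (hi.trans hab)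
  have hagree : ∀ n, runMeasure M π (U n) = runMeasure M (coverPolicy L D C π) (U n) := by
    refine fun n => runMeasure_eq_of_agree M _ _ n _ (hadapt n) fun ρ _ hρ i hi => ?_
    rw [coverPolicy, dif_neg]
    rw [prodState_fin]
    rintro ⟨a, j, hj, -⟩
    exact hρ i hi ⟨j, hj⟩
  have hcompl : ∀ n, runMeasure M π (U n)ᶜ = runMeasure M (coverPolicy L D C π) (U n)ᶜ := by
    intro n
    rw [prob_compl_eq_one_sub (hU n), prob_compl_eq_one_sub (hU n), hagree n]
  rw [hunion, hmono.measure_iUnion, hmono.measure_iUnion]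
  exact iSup_congr hcompl

variable [Fintype Q]

/-- As rewards are eventually constant, the limit-average reward is the probability of being
rewarded from some time on. -/
lemma limAvg_eq (hC : IsASECCover M.trans L D C) (π : Policy S A) :
    limAvg M (asecMachine L D C) π =
      (runMeasure M π).real {ρ | ∀ᶠ n in Filter.atTop, Rewarded L D C ρ n} := by
  classical
  set W := {ρ : Run S A | ∀ᶠ n in Filter.atTop, Rewarded L D C ρ n}
  have hr : ∀ (ρ : Run S A) n, 0 ≤ (if Rewarded L D C ρ n then 1 else 0 : ℝ) ∧
      (if Rewarded L D C ρ n then 1 else 0 : ℝ) ≤ 1 := by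
    intro ρ n
    split_ifs <;> norm_num
  have hlim : Filter.Tendsto (fun t : ℕ => ∫ ρ, (1 / (t : ℝ)) * ∑ i ∈ Finset.range t,
      (if Rewarded L D C ρ i then 1 else 0 : ℝ) ∂(runMeasure M π)) Filter.atTop
      (nhds (∫ ρ, W.indicator 1 ρ ∂(runMeasure M π))) := by
    refine tendsto_integral_of_dominated_convergence (fun _ => 1) ?_ (integrable_const _) ?_ ?_
    · intro t
      refine Measurable.aestronglyMeasurable (Measurable.const_mul ?_ _)
      refine Finset.measurable_sum _ fun i _ => ?_
      exact Measurable.ite (measurableSet_rewarded i) measurable_const measurable_const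
    · intro t
      refine Filter.Eventually.of_forall fun ρ => ?_
      rw [Real.norm_of_nonneg (mul_nonneg (by positivity)
        (Finset.sum_nonneg fun i _ => (hr ρ i).1)), one_div, inv_mul_eq_div]
      refine div_le_one_of_le₀ ?_ (Nat.cast_nonneg t)
      refine (Finset.sum_le_sum fun i _ => (hr ρ i).2).trans ?_
      simp
    · filter_upwards [ae_run_support M π] with ρ hρ
      simp only [one_div]
      refine Filter.Tendsto.cesaro (tendsto_const_nhds.congr' ?_)
      rcases eventually_rewarded_or hC fun n => (hρ n).1 with h | h
      · filter_upwards [h] with n hn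
        rw [if_pos hn, Set.indicator_of_mem (show ρ ∈ W from h)]
        rfl
      · have hW : ρ ∉ W := fun hW => by
          obtain ⟨n, h1, h2⟩ := (h.and hW).exists
          exact h1 h2
        filter_upwards [h] with n hn
        rw [if_neg hn, Set.indicator_of_notMem hW]
  rw [limAvg]
  simp only [asecMachine_rew]
  rw [hlim.liminf_eq, integral_indicator_one measurableSet_eventually_rewarded]

theorem limAvg_le_accProb (hC : IsASECCover M.trans L D C) (π : Policy S A) :
    limAvg M (asecMachine L D C) π ≤ accProb M L D π := by
  rw [limAvg_eq hC, accProb, measureReal_def, measureReal_def]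
  refine ENNReal.toReal_mono (measure_ne_top _ _) (measure_mono_ae ?_)
  filter_upwards [ae_run_support M π, ae_fairRun L D M π] with ρ h1 h2 h3
  exact accepts_of_eventually_rewarded hC (fun n => (h1 n).1) h2 h3

/-- Under `coverPolicy` the machine never enters the sink, and covered states lead to covered
states. -/
lemma ae_eventually_rewarded_of_covered (hC : IsASECCover M.trans L D C) (π : Policy S A) :
    ∀ᵐ ρ ∂runMeasure M (coverPolicy L D C π), (∃ n, Covered C (prodSeq L D ρ n)) →
      ∀ᶠ n in Filter.atTop, Rewarded L D C ρ n := by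
  filter_upwards [ae_run_support M (coverPolicy L D C π)] with ρ hρ
  rintro ⟨k, hk⟩
  have hact : ∀ n, Covered C (prodSeq L D ρ n) → (ρ n).2 ∈ firstAct C (prodSeq L D ρ n) := by
    intro n hn
    have h := hn.firstAct_nonempty fun i => (hC.1 i).2
    have h1 := (hρ n).2
    rw [← prodState_fin] at h ⊢
    rw [coverPolicy, dif_pos h, ← PMF.mem_support_iff, PMF.support_pure,
      Set.mem_singleton_iff] at h1
    rw [h1]
    exact h.choose_spec
  have hne : ∀ n, (asecMachine L D C).stateSeq ρ n ≠ none := by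
    intro n
    induction n with
    | zero => exact Option.some_ne_none _
    | succ n ih => exact (asecMachine_stateSeq_succ_ne_none_iff ρ n).2 ⟨ih, hact n⟩
  refine Filter.eventually_atTop.2 ⟨k, fun n hn => ?_⟩
  induction n, hn using Nat.le_induction with
  | base => exact ⟨hne k, hk⟩
  | succ n _ ih => exact ih.succ hC (fun n => (hρ n).1) (hne _)

theorem accProb_le_limAvg_coverPolicy (hC : IsASECCover M.trans L D C) (π : Policy S A) :
    accProb M L D π ≤ limAvg M (asecMachine L D C) (coverPolicy L D C π) := by
  rw [limAvg_eq hC, accProb, measureReal_def, measureReal_def]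
  refine ENNReal.toReal_mono (measure_ne_top _ _) ?_
  calc runMeasure M π {ρ | D.Accepts fun i => L (ρ.trans i)}
      ≤ runMeasure M π {ρ | ∃ n, Covered C (prodSeq L D ρ n)} := by
        refine measure_mono_ae ?_
        filter_upwards [ae_run_support M π, ae_fairRun L D M π] with ρ h1 h2 h3
        exact DRA.Accepts.exists_covered L D hC h3 h2 fun n => (h1 n).1
    _ = runMeasure M (coverPolicy L D C π) {ρ | ∃ n, Covered C (prodSeq L D ρ n)} :=
        runMeasure_covered_eq M L D C π
    _ ≤ _ := measure_mono_ae (ae_eventually_rewarded_of_covered hC π)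

end Values

end RLSpec

theorem mainTheorem4 {S A Q AP : Type*}
    [Fintype S] [MeasurableSpace S] [MeasurableSingletonClass S]
    [Fintype A] [MeasurableSpace A] [MeasurableSingletonClass A] [Fintype Q]
    (s₀ : S) (E : Set (S × A × S)) (L : S × A × S → Set AP) (D : RLSpec.DRA Q AP) :
    (∃ n ≤ Fintype.card (S × Q), ∃ C : Fin n → RLSpec.SubMDP (S × Q) A,
      ∀ P : RLSpec.TransFun S A, P.supp = E → RLSpec.IsASECCover P L D C) ∧
    ∀ (n : ℕ) (C : Fin n → RLSpec.SubMDP (S × Q) A) (P₀ : RLSpec.TransFun S A),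
      P₀.supp = E → RLSpec.IsASECCover P₀ L D C →
      ∀ P : RLSpec.TransFun S A, P.supp = E →
        (∀ π : RLSpec.Policy S A,
          RLSpec.Maximises (RLSpec.limAvg ⟨s₀, P⟩ (RLSpec.asecMachine L D C)) π →
          RLSpec.Maximises (RLSpec.accProb ⟨s₀, P⟩ L D) π) ∧
        (∀ π : RLSpec.Policy S A,
          RLSpec.limAvg ⟨s₀, P⟩ (RLSpec.asecMachine L D C) π ≤ RLSpec.accProb ⟨s₀, P⟩ L D π) ∧
        (∀ π : RLSpec.Policy S A, ∃ π' : RLSpec.Policy S A,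
          RLSpec.accProb ⟨s₀, P⟩ L D π ≤
            RLSpec.limAvg ⟨s₀, P⟩ (RLSpec.asecMachine L D C) π') := by
  constructor
  · by_cases hE : ∃ P₀ : RLSpec.TransFun S A, P₀.supp = E
    · obtain ⟨P₀, rfl⟩ := hE
      obtain ⟨n, hn, C, hC⟩ := RLSpec.exists_cover P₀ L D
      exact ⟨n, hn, C, fun P hP => RLSpec.IsASECCover_congr hP.symm hC⟩
    · exact ⟨0, Nat.zero_le _, Fin.elim0, fun P hP => absurd ⟨P, hP⟩ hE⟩
  · rintro n C P₀ rfl hC₀ P hP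
    have hC := RLSpec.IsASECCover_congr hP.symm hC₀
    have h2 := fun π => RLSpec.limAvg_le_accProb (M := ⟨s₀, P⟩) hC π
    have h3 := fun π => RLSpec.accProb_le_limAvg_coverPolicy (M := ⟨s₀, P⟩) hC π
    exact ⟨fun π hπ π' => ((h3 π').trans (hπ _)).trans (h2 π), h2, fun π => ⟨_, h3 π⟩⟩
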